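/- Let $\Pi_\sigma=\{s\in\mathbb{C}:\operatorname{Re}s>\sigma\}$ and $\Pi=\Pi_0$. For a set $G\subset\mathbb{C}$, the Rogosinski abscissa $\mathbf{r}(G)$ is the infimum (in $[0,\infty]$) of all real $\sigma'\ge 0$ with the following property: for every bounded holomorphic function $f$ on $\Pi$ with $f(\Pi)\subset G$ that is the sum in $\Pi$ of a convergent Dirichlet series $f(s)=\sum_{n=1}^{\infty}a_n n^{-s}$, all partial sums $P_k(s)=\sum_{n=1}^{k}a_n n^{-s}$ $(k\ge 1)$ satisfy $P_k(\Pi_{\sigma'})\subset G$. The abscissa $\mathbf{r}_a(G)$ is defined in the same manner, but considering only those $f$ whose Dirichlet series converges absolutely at every point of $\Pi$. Theorem 3.4. Let $G\subset\mathbb{C}$ be a (non-empty, open) convex domain. If $G$ is bounded, then $\mathbf{r}(G)\ge 1$. If $G\neq\mathbb{C}$, bounded or not, then $\mathbf{r}_a(G)\ge 1$. -/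

import Mathlib

open Set Filter Topology

/-- The open half-plane of all `s` with real part greater than `σ`. -/
def rightHalfPlane (σ : ℝ) : Set ℂ := {s : ℂ | σ < s.re}

/-- The partial sum `∑_{n=1}^k a_n / n^s` of the ordinary Dirichlet series with
coefficients `a` (the value `a 0` plays no role). -/
noncomputable def dirichletPartialSum (a : ℕ → ℂ) (k : ℕ) (s : ℂ) : ℂ :=
  ∑ n ∈ Finset.Icc 1 k, a n / (n : ℂ) ^ s

/-- `f` belongs to `H^∞` of the right half-plane `{Re s > 0}` and is there the sum of the
(possibly only conditionally) convergent Dirichlet series `∑_{n ≥ 1} a_n / n^s`. -/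
structure IsHInftyDirichletSeries (a : ℕ → ℂ) (f : ℂ → ℂ) : Prop where
  tendsto_partialSum : ∀ s ∈ rightHalfPlane 0,
    Tendsto (fun k : ℕ => dirichletPartialSum a k s) atTop (𝓝 (f s))
  differentiableOn : DifferentiableOn ℂ f (rightHalfPlane 0)
  isBounded_image : Bornology.IsBounded (f '' rightHalfPlane 0)

/-- The Rogosinski abscissa `r(G)`: the infimum of all `σ ≥ 0` such that, for every `f` in `H^∞`
of the right half-plane given by a Dirichlet series and with values in `G`, all partial sums
(with at least one term) map `{Re s > σ}` into `G`. The infimum is taken in the extended reals,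
so that it has no junk value. -/
noncomputable def rogosinskiAbscissa (G : Set ℂ) : EReal :=
  sInf ((fun σ : ℝ => (σ : EReal)) '' {σ : ℝ | 0 ≤ σ ∧
    ∀ (a : ℕ → ℂ) (f : ℂ → ℂ), IsHInftyDirichletSeries a f →
      MapsTo f (rightHalfPlane 0) G →
      ∀ k : ℕ, 1 ≤ k → MapsTo (dirichletPartialSum a k) (rightHalfPlane σ) G})

/-- The Rogosinski abscissa `r_a(G)`: the same infimum, where only those series are considered
that converge absolutely at every point of the right half-plane. -/
noncomputable def rogosinskiAbscissaAbs (G : Set ℂ) : EReal :=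
  sInf ((fun σ : ℝ => (σ : EReal)) '' {σ : ℝ | 0 ≤ σ ∧
    ∀ (a : ℕ → ℂ) (f : ℂ → ℂ), IsHInftyDirichletSeries a f →
      (∀ s ∈ rightHalfPlane 0, LSeriesSummable a s) →
      MapsTo f (rightHalfPlane 0) G →
      ∀ k : ℕ, 1 ≤ k → MapsTo (dirichletPartialSum a k) (rightHalfPlane σ) G})

/-! Take `p` in `G` and a nearest point `b` of the complement, so the disc about `p` through `b`
lies in `G`. Compose the disc automorphism `z ↦ (a + z) / (1 + a * z)`, scaled to this disc, with `z
= 2 ^ (-s)`. The second partial sum is `p + (b - p) * (a + (1 - a ^ 2) * 2 ^ (-s))`; it equals `b ∉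
G` at `s = t` when `1 + a = 2 ^ t`. Every `t < 1` with `t ≥ 0` gives `0 ≤ a < 1`, so no `σ < 1` is
admissible. -/

theorem LSeriesHasSum.tendsto_dirichletPartialSum {a : ℕ → ℂ} {s w : ℂ}
    (h : LSeriesHasSum a s w) :
    Tendsto (fun k : ℕ => dirichletPartialSum a k s) atTop (𝓝 w) := by
  -- `range (k + 1)` also contains the index `0`, whose term vanishes.
  refine ((tendsto_add_atTop_iff_nat 1).2 (HasSum.tendsto_sum_nat h)).congr fun k => ?_
  rw [Finset.sum_range_succ', dirichletPartialSum, LSeries.term_zero, add_zero,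
    ← Finset.Ico_add_one_right_eq_Icc, Finset.sum_Ico_eq_sum_range, add_tsub_cancel_right]
  refine Finset.sum_congr rfl fun n _ => ?_
  rw [LSeries.term_of_ne_zero (by omega), add_comm 1 n]

/-- The Dirichlet series in powers of `2 ^ (-s)` with the coefficients of a power series. -/
noncomputable def dyadicCoeff (b : ℕ → ℂ) : ℕ → ℂ :=
  Function.extend (fun j : ℕ => 2 ^ j) b 0

theorem dyadicCoeff_two_pow (b : ℕ → ℂ) (j : ℕ) : dyadicCoeff b (2 ^ j) = b j :=
  (Nat.pow_right_injective le_rfl).extend_apply b 0 j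

theorem LSeriesHasSum_dyadicCoeff {b : ℕ → ℂ} {s w : ℂ}
    (h : HasSum (fun j : ℕ => b j * ((2 : ℂ) ^ (-s)) ^ j) w) :
    LSeriesHasSum (dyadicCoeff b) s w := by
  have hinj : Function.Injective (fun j : ℕ => 2 ^ j) := Nat.pow_right_injective le_rfl
  refine (hinj.hasSum_iff fun n hn => ?_).1 (h.congr_fun fun j => ?_)
  · have : dyadicCoeff b n = 0 := Function.extend_apply' _ _ _ hn
    rw [LSeries.term_def, this]
    simp
  · have hpow : ((2 ^ j : ℕ) : ℂ) ^ s = ((2 : ℂ) ^ s) ^ j := by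
      rw [Nat.cast_pow, ← Complex.natCast_cpow_natCast_mul, Complex.cpow_nat_mul]
      simp
    simp only [Function.comp_apply]
    rw [LSeries.term_of_ne_zero (by positivity), dyadicCoeff_two_pow, hpow, Complex.cpow_neg,
      inv_pow, div_eq_mul_inv]

/-- The Taylor coefficients of `z ↦ p + d * (a + z) / (1 + a * z)`. -/
noncomputable def moebiusCoeff (p d : ℂ) (a : ℝ) : ℕ → ℂ
  | 0 => p + d * a
  | j + 1 => d * (1 - a ^ 2) * (-a) ^ j

theorem one_add_mul_ne_zero {a : ℝ} (ha0 : 0 ≤ a) (ha1 : a < 1) {z : ℂ} (hz : ‖z‖ < 1) :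
    1 + (a : ℂ) * z ≠ 0 := by
  intro h
  have h1 : ‖(a : ℂ) * z‖ = 1 := by
    rw [eq_neg_of_add_eq_zero_right h, norm_neg, norm_one]
  rw [norm_mul, Complex.norm_of_nonneg ha0] at h1
  nlinarith [norm_nonneg z]

theorem hasSum_moebiusCoeff (p d : ℂ) {a : ℝ} (ha0 : 0 ≤ a) (ha1 : a < 1) {z : ℂ}
    (hz : ‖z‖ < 1) :
    HasSum (fun j => moebiusCoeff p d a j * z ^ j) (p + d * ((a + z) / (1 + a * z))) := by
  have hne := one_add_mul_ne_zero ha0 ha1 hz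
  have hlt : ‖-(a : ℂ) * z‖ < 1 := by
    rw [norm_mul, norm_neg, Complex.norm_of_nonneg ha0]
    nlinarith [norm_nonneg z]
  rw [← hasSum_nat_add_iff' 1]
  have hw : p + d * ((a + z) / (1 + a * z)) - ∑ j ∈ Finset.range 1, moebiusCoeff p d a j * z ^ j
      = d * (1 - a ^ 2) * z * (1 - -(a : ℂ) * z)⁻¹ := by
    rw [Finset.sum_range_one, moebiusCoeff, show 1 - -(a : ℂ) * z = 1 + a * z by ring]
    field_simp
    ring
  rw [hw]
  refine ((hasSum_geometric_of_norm_lt_one hlt).mul_left (d * (1 - a ^ 2) * z)).congr_fun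
    fun j => ?_
  simp only [moebiusCoeff]
  ring

theorem norm_moebius_lt_one {a : ℝ} (ha0 : 0 ≤ a) (ha1 : a < 1) {z : ℂ} (hz : ‖z‖ < 1) :
    ‖(a + z) / (1 + a * z)‖ < 1 := by
  rw [norm_div, div_lt_one (norm_pos_iff.2 (one_add_mul_ne_zero ha0 ha1 hz))]
  refine lt_of_pow_lt_pow_left₀ 2 (norm_nonneg _) ?_
  have hz2 : ‖z‖ ^ 2 < 1 := by nlinarith [norm_nonneg z]
  rw [← Complex.normSq_eq_norm_sq, Complex.normSq_apply] at hz2 ⊢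
  rw [← Complex.normSq_eq_norm_sq, Complex.normSq_apply]
  simp only [Complex.add_re, Complex.add_im, Complex.mul_re, Complex.mul_im, Complex.ofReal_re,
    Complex.ofReal_im, Complex.one_re, Complex.one_im]
  have ha2 : 0 < 1 - a ^ 2 := by nlinarith
  -- `|1 + a z|² - |a + z|² = (1 - a²)(1 - |z|²)`.
  nlinarith [mul_pos ha2 (sub_pos.2 hz2)]

theorem norm_two_cpow_neg_lt_one {s : ℂ} (hs : s ∈ rightHalfPlane 0) :
    ‖(2 : ℂ) ^ (-s)‖ < 1 := by
  have h : ‖((2 : ℕ) : ℂ) ^ (-s)‖ = ((2 : ℕ) : ℝ) ^ (-s).re :=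
    Complex.norm_natCast_cpow_of_pos two_pos _
  push_cast at h
  rw [h]
  exact Real.rpow_lt_one_of_one_lt_of_neg one_lt_two (neg_lt_zero.2 hs)

/-- Testing fewer series admits more `σ`, so the bounded case reduces to absolutely convergent
series. -/
theorem rogosinskiAbscissaAbs_le (G : Set ℂ) :
    rogosinskiAbscissaAbs G ≤ rogosinskiAbscissa G :=
  sInf_le_sInf (image_mono fun _ hσ => ⟨hσ.1, fun a f hf _ => hσ.2 a f hf⟩)

theorem one_le_rogosinskiAbscissaAbs {G : Set ℂ} (hG_open : IsOpen G) (hG_nonempty : G.Nonempty)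
    (hG : G ≠ univ) : 1 ≤ rogosinskiAbscissaAbs G := by
  refine le_sInf ?_
  rintro _ ⟨σ, ⟨hσ0, hσ⟩, rfl⟩
  rw [← EReal.coe_one, EReal.coe_le_coe_iff]
  by_contra! hσ1
  obtain ⟨t, hσt, ht1⟩ := exists_between hσ1
  obtain ⟨p, hp⟩ := hG_nonempty
  obtain ⟨b, hb, hpb⟩ := hG_open.isClosed_compl.exists_infDist_eq_dist (nonempty_compl.2 hG) p
  have hball : Metric.ball p (dist p b) ⊆ G := by
    intro w hw
    by_contra hwG
    rw [Metric.mem_ball, ← hpb, dist_comm] at hw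
    exact absurd (Metric.infDist_le_dist_of_mem (mem_compl hwG)) (not_le.2 hw)
  have hd : 0 < ‖b - p‖ := norm_pos_iff.2 (sub_ne_zero.2 fun h => hb (h ▸ hp))
  -- Solves `a + (1 - a ^ 2) * 2 ^ (-t) = 1` with `a ≠ 1`.
  set a : ℝ := 2 ^ t - 1 with ha
  have ha0 : 0 ≤ a := sub_nonneg.2 (Real.one_le_rpow one_le_two (hσ0.trans hσt.le))
  have ha1 : a < 1 := by
    have := Real.rpow_lt_rpow_of_exponent_lt one_lt_two ht1
    rw [Real.rpow_one] at this
    linarith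
  set f : ℂ → ℂ := fun s =>
    p + (b - p) * ((a + (2 : ℂ) ^ (-s)) / (1 + a * (2 : ℂ) ^ (-s))) with hf
  have hsum : ∀ s ∈ rightHalfPlane 0,
      LSeriesHasSum (dyadicCoeff (moebiusCoeff p (b - p) a)) s (f s) := fun s hs =>
    LSeriesHasSum_dyadicCoeff (hasSum_moebiusCoeff p (b - p) ha0 ha1 (norm_two_cpow_neg_lt_one hs))
  have hmaps : MapsTo f (rightHalfPlane 0) (Metric.ball p (dist p b)) := by
    intro s hs
    rw [Metric.mem_ball, dist_comm p b, dist_eq_norm, dist_eq_norm, hf, add_sub_cancel_left,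
      norm_mul]
    exact mul_lt_of_lt_one_right hd
      (norm_moebius_lt_one ha0 ha1 (norm_two_cpow_neg_lt_one hs))
  have hseries : IsHInftyDirichletSeries (dyadicCoeff (moebiusCoeff p (b - p) a)) f := by
    refine ⟨fun s hs => (hsum s hs).tendsto_dirichletPartialSum, ?_,
      Metric.isBounded_ball.subset hmaps.image_subset⟩
    intro s hs
    have hz : DifferentiableAt ℂ (fun s : ℂ => (2 : ℂ) ^ (-s)) s :=
      differentiableAt_id.neg.const_cpow (Or.inl two_ne_zero)
    exact ((((hz.const_add _).div ((hz.const_mul _).const_add _)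
      (one_add_mul_ne_zero ha0 ha1 (norm_two_cpow_neg_lt_one hs))).const_mul _).const_add
        _).differentiableWithinAt
  -- The sum up to `n = 2` holds exactly the constant and linear Taylor terms; its value at `t` is
  -- `b`.
  have hmem := hσ _ f hseries (fun s hs => (hsum s hs).LSeriesSummable)
    (hmaps.mono_right hball) 2 one_le_two (show (t : ℂ) ∈ rightHalfPlane σ from hσt)
  refine hb ?_
  convert hmem using 1
  have hpow : (2 : ℂ) ^ (t : ℂ) = a + 1 := by
    rw [ha, Complex.ofReal_sub, Complex.ofReal_cpow zero_le_two]
    simp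
  have hne : (a : ℂ) + 1 ≠ 0 := by
    rw [← hpow]
    simp
  have h1 := dyadicCoeff_two_pow (moebiusCoeff p (b - p) a) 0
  have h2 := dyadicCoeff_two_pow (moebiusCoeff p (b - p) a) 1
  rw [pow_zero] at h1
  rw [pow_one] at h2
  rw [dirichletPartialSum, Finset.sum_Icc_succ_top one_le_two, Finset.Icc_self,
    Finset.sum_singleton, h1, h2, Nat.cast_one, Complex.one_cpow, one_add_one_eq_two,
    Nat.cast_ofNat, hpow]
  simp only [moebiusCoeff]
  field_simp
  ring

theorem theorem3p4 (G : Set ℂ) (hG_open : IsOpen G) (hG_nonempty : G.Nonempty)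
    (hG_convex : Convex ℝ G) :
    (Bornology.IsBounded G → 1 ≤ rogosinskiAbscissa G) ∧
      (G ≠ Set.univ → 1 ≤ rogosinskiAbscissaAbs G) := by
  refine ⟨fun hG => ?_, one_le_rogosinskiAbscissaAbs hG_open hG_nonempty⟩
  refine (one_le_rogosinskiAbscissaAbs hG_open hG_nonempty ?_).trans (rogosinskiAbscissaAbs_le G)
  rintro rfl
  exact NormedSpace.unbounded_univ ℝ ℂ hG
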